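/- Let $X$ be a compactum, i.e. a compact Hausdorff space, and let $C(X)$ be the space of continuous functions $X\to\mathbb R$. An idempotent measure on $X$ is a functional $\mu\colon C(X)\to\mathbb R$ such that $\mu(1_X)=1$, $\mu(c_X+\varphi)=c+\mu(\varphi)$ and $\mu(\max\{\psi,\varphi\})=\max\{\mu(\psi),\mu(\varphi)\}$ for all $c\in\mathbb R$ and $\varphi,\psi\in C(X)$, where $c_X$ is the constant function with value $c$. Let $IX$ be the set of all idempotent measures on $X$, with the topology of a subspace of the product $\mathbb R^{C(X)}$; it is a compactum. An $\omega$-system is an inverse system $\{X_\alpha,p^\beta_\alpha,\mathcal A\}$ of compacta of countable weight with continuous surjective bonding maps $p^\beta_\alpha\colon X_\beta\to X_\alpha$ ($\alpha\le\beta$), over a partially ordered set $\mathcal A$ in which every countable subset has a least upper bound, which is continuous: for every nonempty chain $B\subset\mathcal A$ with a least upper bound $\beta\in\mathcal A$, the canonical map $X_\beta\to\varprojlim_{\alpha\in B}X_\alpha$ is a homeomorphism. A compactum is called openly generated if it is homeomorphic to the limit of an $\omega$-system all of whose bonding maps are open. Then the compactum $IX$ is openly generated if and only if $X$ is openly generated.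 -/

import Mathlib

universe u v

/-- An idempotent (Maslov) measure on `X`: a functional `μ : C(X) → ℝ` with `μ(1_X) = 1`,
`μ(c ⊙ φ) = c ⊙ μ(φ)` and `μ(ψ ⊕ φ) = μ(ψ) ⊕ μ(φ)`, where `⊙` is `+` and `⊕` is `max`. -/
structure IsIdempotentMeasure {X : Type u} [TopologicalSpace X] (μ : C(X, ℝ) → ℝ) : Prop where
  map_one : μ (ContinuousMap.const X 1) = 1
  map_odot : ∀ (c : ℝ) (φ : C(X, ℝ)), μ (ContinuousMap.const X c + φ) = c + μ φ
  map_oplus : ∀ ψ φ : C(X, ℝ), μ (ψ ⊔ φ) = max (μ ψ) (μ φ)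

/-- The space `IX` of idempotent measures on `X`. Being a reducible subtype, it carries the
subspace topology of the product `ℝ ^ C(X)`. -/
abbrev IdempotentMeasure (X : Type u) [TopologicalSpace X] : Type u :=
  {μ : C(X, ℝ) → ℝ // IsIdempotentMeasure μ}

/-- The limit of an inverse system: the space of threads, a subspace of the product. -/
abbrev inverseLimit {A : Type u} [Preorder A] {F : A → Type v}
    (p : ∀ ⦃a b : A⦄, a ≤ b → F b → F a) : Type (max u v) :=
  {x : ∀ a, F a // ∀ (a b : A) (h : a ≤ b), p h (x b) = x a}

/-- The restriction of an inverse system to a subset of the index set. -/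
abbrev restrictBonding {A : Type u} [Preorder A] {F : A → Type v}
    (p : ∀ ⦃a b : A⦄, a ≤ b → F b → F a) (B : Set A) :
    ∀ ⦃a b : B⦄, a ≤ b → F b → F a :=
  fun _ _ h => p (Subtype.coe_le_coe.mpr h)

/-- The canonical map `F β → lim (F a)_{a ∈ B}`, for an upper bound `β` of `B`. -/
def toRestrictedLimit {A : Type u} [Preorder A] {F : A → Type v}
    (p : ∀ ⦃a b : A⦄, a ≤ b → F b → F a) [InverseSystem p]
    {B : Set A} {β : A} (hβ : β ∈ upperBounds B) (x : F β) :
    inverseLimit (restrictBonding p B) :=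
  ⟨fun a => p (hβ a.2) x, fun _ b h =>
    InverseSystem.map_map (f := p) (Subtype.coe_le_coe.mpr h) (hβ b.2) x⟩

/-- An `ω`-system: an inverse system of compacta of countable weight with continuous surjective
bonding maps, over a partially ordered set in which every countable subset has a least upper bound,
which is continuous: the space at the least upper bound of a nonempty chain is (canonically) the limit of
the spaces along the chain. -/
structure IsOmegaSystem {A : Type u} [PartialOrder A] (F : A → Type v)
    [∀ a, TopologicalSpace (F a)] (p : ∀ ⦃a b : A⦄, a ≤ b → F b → F a) : Prop where
  inverseSystem : InverseSystem p
  compact : ∀ a, CompactSpace (F a)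
  hausdorff : ∀ a, T2Space (F a)
  weight_le : ∀ a, SecondCountableTopology (F a)
  continuous_bonding : ∀ ⦃a b : A⦄ (h : a ≤ b), Continuous (p h)
  surjective_bonding : ∀ ⦃a b : A⦄ (h : a ≤ b), Function.Surjective (p h)
  complete : ∀ B : Set A, B.Countable → ∃ β, IsLUB B β
  continuous_system : ∀ (B : Set A) (β : A), B.Nonempty → IsChain (· ≤ ·) B →
    ∀ hβ : IsLUB B β, IsHomeomorph (toRestrictedLimit p hβ.1)

/-- `X` is openly generated: it is (homeomorphic to) the limit of an `ω`-system with open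
bonding maps. -/
def OpenlyGenerated (X : Type u) [TopologicalSpace X] : Prop :=
  ∃ (A : Type u) (_ : PartialOrder A) (F : A → Type u) (_ : ∀ a, TopologicalSpace (F a))
    (p : ∀ ⦃a b : A⦄, a ≤ b → F b → F a),
    IsOmegaSystem F p ∧ (∀ ⦃a b : A⦄ (h : a ≤ b), IsOpenMap (p h)) ∧
      Nonempty (X ≃ₜ inverseLimit p)

/-! Write `I` for the functor `map`. The property transfers because open surjections and saturations
can be compared across `I`, and because countable-weight quotients of `IX` and of `X` can be matched
cofinally.

If `f` is an open surjection of compacta, fibrewise maxima `M φ` are continuous, and a weight `g ≤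
0` with maximum 0 on each fibre gives a continuous section `ν ↦ (φ ↦ ν (M (φ + g)))` of `I f`.
Choosing `g` as a continuous stand-in for a conditional density makes the section pass near any
prescribed `μ` (`exists_section_approx`), so `I f` is open. Applying `I` to the limit projections of
`X` then yields a suitable family on `IX`.

Conversely, let `q a` be the projections of `IX` and `f a` their restrictions to Dirac measures. A
back-and-forth argument gives cofinally many stages where `q a` and `I (f a)` have the same fibres.
There `I (f a)` has open saturations of open sets, and `isOpen_preimage_image_of_map` passes this
down to `f a`. Since `f a` need not be surjective, saturations replace openness.

Both directions end in `openlyGenerated_of_family`, which rebuilds an ω-system from such a family of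
maps. -/

open Set Topology

namespace IdempotentMeasure

/-! ### Elementary properties, compactness and functoriality of `IX`. -/

section Basic

variable {X : Type*} [TopologicalSpace X]

theorem map_add_const (μ : IdempotentMeasure X) (c : ℝ) (φ : C(X, ℝ)) :
    μ.1 (ContinuousMap.const X c + φ) = c + μ.1 φ :=
  μ.2.map_odot c φ

theorem map_const (μ : IdempotentMeasure X) (c : ℝ) : μ.1 (ContinuousMap.const X c) = c := by
  have h := μ.2.map_odot (c - 1) (ContinuousMap.const X 1)
  rw [μ.2.map_one] at h
  have e : ContinuousMap.const X (c - 1) + ContinuousMap.const X 1 = ContinuousMap.const X c := by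
    ext; simp
  rw [e] at h
  linarith

theorem mono (μ : IdempotentMeasure X) {φ ψ : C(X, ℝ)} (h : φ ≤ ψ) : μ.1 φ ≤ μ.1 ψ := by
  have := μ.2.map_oplus φ ψ
  rw [sup_eq_right.2 h] at this
  rw [this]
  exact le_max_left _ _

theorem le_add_of_le (μ : IdempotentMeasure X) {φ ψ : C(X, ℝ)} {c : ℝ}
    (h : ∀ x, φ x ≤ c + ψ x) : μ.1 φ ≤ c + μ.1 ψ := by
  rw [← μ.map_add_const]
  exact μ.mono fun x => h x

theorem abs_sub_le (μ : IdempotentMeasure X) {φ ψ : C(X, ℝ)} {c : ℝ}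
    (h : ∀ x, |φ x - ψ x| ≤ c) : |μ.1 φ - μ.1 ψ| ≤ c := by
  have h1 := μ.le_add_of_le (φ := φ) (ψ := ψ) (c := c) fun x => by linarith [(abs_le.1 (h x)).2]
  have h2 := μ.le_add_of_le (φ := ψ) (ψ := φ) (c := c) fun x => by linarith [(abs_le.1 (h x)).1]
  exact abs_le.2 ⟨by linarith, by linarith⟩

theorem abs_le_of_le (μ : IdempotentMeasure X) {φ : C(X, ℝ)} {c : ℝ}
    (h : ∀ x, |φ x| ≤ c) : |μ.1 φ| ≤ c := by
  have := μ.abs_sub_le (φ := φ) (ψ := ContinuousMap.const X 0) (c := c) (by simpa using h)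
  rwa [map_const, sub_zero] at this

theorem continuous_eval (φ : C(X, ℝ)) : Continuous fun μ : IdempotentMeasure X => μ.1 φ :=
  (continuous_apply φ).comp continuous_subtype_val

theorem isClosed_setOf_isIdempotentMeasure :
    IsClosed {μ : C(X, ℝ) → ℝ | IsIdempotentMeasure μ} := by
  have e : {μ : C(X, ℝ) → ℝ | IsIdempotentMeasure μ} =
      {μ | μ (ContinuousMap.const X 1) = 1} ∩
      ((⋂ (c : ℝ) (φ : C(X, ℝ)), {μ | μ (ContinuousMap.const X c + φ) = c + μ φ}) ∩
        ⋂ (ψ : C(X, ℝ)) (φ : C(X, ℝ)), {μ | μ (ψ ⊔ φ) = max (μ ψ) (μ φ)}) := by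
    ext μ
    simp only [mem_ofPred_eq, mem_inter_iff, mem_iInter]
    exact ⟨fun h => ⟨h.1, h.2, h.3⟩, fun h => ⟨h.1, h.2.1, h.2.2⟩⟩
  rw [e]
  refine (isClosed_eq (by fun_prop) (by fun_prop)).inter (IsClosed.inter ?_ ?_)
  · exact isClosed_iInter fun c => isClosed_iInter fun φ => isClosed_eq (by fun_prop) (by fun_prop)
  · exact isClosed_iInter fun ψ => isClosed_iInter fun φ => isClosed_eq (by fun_prop) (by fun_prop)

instance compactSpace [CompactSpace X] : CompactSpace (IdempotentMeasure X) := by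
  have hind : IsInducing (Subtype.val : IdempotentMeasure X → C(X, ℝ) → ℝ) := ⟨rfl⟩
  have hrange : range (Subtype.val : IdempotentMeasure X → C(X, ℝ) → ℝ) =
      {μ : C(X, ℝ) → ℝ | IsIdempotentMeasure μ} := by
    ext μ; simp
  rw [← isCompact_univ_iff, hind.isCompact_iff, image_univ, hrange]
  refine (isCompact_univ_pi fun φ : C(X, ℝ) => isCompact_Icc (a := -‖φ‖) (b := ‖φ‖)).of_isClosed_subset
    isClosed_setOf_isIdempotentMeasure fun μ hμ φ _ => ?_
  exact abs_le.1 (abs_le_of_le ⟨μ, hμ⟩ fun x => φ.norm_coe_le_norm x)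

variable {Y : Type*} [TopologicalSpace Y] {Z : Type*} [TopologicalSpace Z]

/-- The push-forward of an idempotent measure. -/
def map (f : C(X, Y)) (μ : IdempotentMeasure X) : IdempotentMeasure Y :=
  ⟨fun ψ => μ.1 (ψ.comp f),
    ⟨μ.2.map_one, fun c φ => μ.2.map_odot c (φ.comp f),
      fun ψ φ => μ.2.map_oplus (ψ.comp f) (φ.comp f)⟩⟩

theorem map_apply (f : C(X, Y)) (μ : IdempotentMeasure X) (ψ : C(Y, ℝ)) :
    (map f μ).1 ψ = μ.1 (ψ.comp f) := rfl

theorem map_comp (g : C(Y, Z)) (f : C(X, Y)) (μ : IdempotentMeasure X) :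
    map (g.comp f) μ = map g (map f μ) := rfl

theorem continuous_map (f : C(X, Y)) : Continuous (map f) :=
  continuous_induced_rng.2 (continuous_pi fun ψ : C(Y, ℝ) => continuous_eval (ψ.comp f))

/-- The Dirac measure at a point. -/
def dirac (x : X) : IdempotentMeasure X :=
  ⟨fun φ => φ x, ⟨rfl, fun _ _ => rfl, fun _ _ => rfl⟩⟩

theorem dirac_apply (x : X) (φ : C(X, ℝ)) : (dirac x).1 φ = φ x := rfl

theorem map_dirac (f : C(X, Y)) (x : X) : map f (dirac x) = dirac (f x) := rfl

theorem continuous_dirac : Continuous (dirac : X → IdempotentMeasure X) :=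
  continuous_induced_rng.2 (continuous_pi fun φ : C(X, ℝ) => φ.continuous)

theorem dirac_injective [CompactSpace X] [T2Space X] :
    Function.Injective (dirac : X → IdempotentMeasure X) := by
  intro x y h
  by_contra hne
  obtain ⟨f, h0, h1, -⟩ := exists_continuous_zero_one_of_isClosed (isClosed_singleton (x := x))
    (isClosed_singleton (x := y)) (by simpa using hne)
  have h0' : f x = 0 := h0 rfl
  have h1' : f y = 1 := h1 rfl
  have : f x = f y := congrFun (congrArg Subtype.val h) f
  rw [h0', h1'] at this
  exact zero_ne_one this

end Basic

/-! ### Determination by dense sets of test functions, and countable weight. -/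

section Dense

variable {X : Type*} [TopologicalSpace X]

theorem eq_of_forall_approx {μ ν : IdempotentMeasure X} (φ : C(X, ℝ))
    (h : ∀ ε > 0, ∃ ψ : C(X, ℝ), (∀ x, |φ x - ψ x| ≤ ε) ∧ μ.1 ψ = ν.1 ψ) : μ.1 φ = ν.1 φ := by
  refine eq_of_forall_dist_le fun ε hε => ?_
  obtain ⟨ψ, hψ, e⟩ := h (ε / 2) (by positivity)
  have h1 := abs_le.1 (μ.abs_sub_le hψ)
  have h2 := abs_le.1 (ν.abs_sub_le hψ)
  rw [Real.dist_eq]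
  exact abs_le.2 ⟨by linarith, by linarith⟩

theorem eq_of_eqOn_dense [CompactSpace X] {D : Set C(X, ℝ)} (hD : Dense D)
    {μ ν : IdempotentMeasure X} (h : ∀ φ ∈ D, μ.1 φ = ν.1 φ) : μ = ν := by
  refine Subtype.ext (funext fun φ => eq_of_forall_approx φ fun ε hε => ?_)
  obtain ⟨ψ, hψ, hd⟩ := hD.exists_dist_lt φ hε
  refine ⟨ψ, fun x => ?_, h ψ hψ⟩
  rw [← Real.dist_eq]
  exact (ContinuousMap.dist_apply_le_dist x).trans hd.le

instance secondCountableTopology [CompactSpace X] [T2Space X] [SecondCountableTopology X] :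
    SecondCountableTopology (IdempotentMeasure X) := by
  obtain ⟨D, hc, hD⟩ := TopologicalSpace.exists_countable_dense C(X, ℝ)
  have : Countable D := hc
  let e : IdempotentMeasure X → D → ℝ := fun μ φ => μ.1 φ
  have he : Continuous e := continuous_pi fun φ => continuous_eval φ.1
  have hi : Function.Injective e := fun μ ν h =>
    eq_of_eqOn_dense hD fun φ hφ => congrFun h ⟨φ, hφ⟩
  exact (he.isClosedEmbedding hi).isEmbedding.secondCountableTopology

end Dense

end IdempotentMeasure

namespace IdempotentMeasure

/-! ### Open surjections are preserved by the functor. -/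

section FiberwiseMaximum

variable {X Y : Type*} [TopologicalSpace X] [CompactSpace X] [TopologicalSpace Y] [T2Space Y]

/-- For an open surjection `f`, fibrewise maxima of continuous functions are continuous. -/
theorem exists_fiberwise_max {f : X → Y} (hf : Continuous f) (ho : IsOpenMap f)
    (hs : Function.Surjective f) (φ : C(X, ℝ)) :
    ∃ Φ : C(Y, ℝ), (∀ x, φ x ≤ Φ (f x)) ∧ ∀ y, ∃ x, f x = y ∧ φ x = Φ y := by
  have hmax : ∀ y, ∃ x, f x = y ∧ ∀ z, f z = y → φ z ≤ φ x := fun y => by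
    obtain ⟨x, hx, h⟩ := ((isClosed_singleton (x := y)).preimage hf).isCompact.exists_isMaxOn
      (hs y) φ.continuous.continuousOn
    exact ⟨x, hx, fun z hz => h hz⟩
  choose m hm hmm using hmax
  refine ⟨⟨fun y => φ (m y), ?_⟩, fun x => hmm _ _ rfl, fun y => ⟨m y, hm y, rfl⟩⟩
  refine OrderTopology.continuous_iff.2 fun c => ⟨?_, ?_⟩
  -- Strict superlevel sets of the maximum are images of open sets, so openness of `f` enters only
  -- here; the other half uses that `f` is closed.
  · convert ho _ (isOpen_Ioi.preimage φ.continuous : IsOpen (φ ⁻¹' Ioi c)) using 1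
    ext y
    refine ⟨fun h => ⟨m y, h, hm y⟩, ?_⟩
    rintro ⟨x, hx, rfl⟩
    exact lt_of_lt_of_le hx (hmm _ _ rfl)
  · rw [← isClosed_compl_iff]
    convert hf.isClosedMap _ (isClosed_Ici.preimage φ.continuous : IsClosed (φ ⁻¹' Ici c)) using 1
    ext y
    refine ⟨fun h => ⟨m y, by simpa using h, hm y⟩, ?_⟩
    rintro ⟨x, hx, rfl⟩
    have : c ≤ φ (m (f x)) := le_trans hx (hmm _ _ rfl)
    simpa using this

/-- Every value `μ φ` of an idempotent measure is attained at a point of the support: the density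
of `μ` at that point is `μ φ - φ x`. -/
theorem exists_forall_sub_le (μ : IdempotentMeasure X) (φ : C(X, ℝ)) :
    ∃ x, ∀ ψ : C(X, ℝ), μ.1 φ - φ x ≤ μ.1 ψ - ψ x := by
  by_contra! h
  choose ψ hψ using h
  let U : X → Set X := fun x => {z | μ.1 (ψ x) - ψ x z < μ.1 φ - φ z}
  have hU : ∀ x, IsOpen (U x) := fun x => isOpen_lt (by fun_prop) (by fun_prop)
  obtain ⟨t, ht⟩ := isCompact_univ.elim_finite_subcover U hU fun x _ => mem_iUnion.2 ⟨x, hψ x⟩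
  have hne : Nonempty X := by
    by_contra hX
    rw [not_nonempty_iff] at hX
    have e : ContinuousMap.const X (0 : ℝ) = ContinuousMap.const X 1 := by
      ext x; exact hX.elim x
    have := μ.map_const 0
    rw [e, μ.map_const] at this
    exact one_ne_zero this
  have htn : t.Nonempty := by
    obtain ⟨x⟩ := hne
    obtain ⟨i, hi, -⟩ := mem_iUnion₂.1 (ht (mem_univ x))
    exact ⟨i, hi⟩
  -- The maximum `Ψ` of the normalised functions `ψ i - μ (ψ i)` has measure 0, yet lies strictly
  -- above `φ - μ φ` everywhere. By compactness the gap is bounded below, which contradicts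
  -- monotonicity.
  have hsup : ∀ s : Finset X, s.Nonempty → ∃ Ψ : C(X, ℝ), μ.1 Ψ = 0 ∧
      ∀ i ∈ s, ∀ z, ψ i z - μ.1 (ψ i) ≤ Ψ z := by
    intro s hs
    induction hs using Finset.Nonempty.cons_induction with
    | singleton a =>
      refine ⟨ContinuousMap.const X (-μ.1 (ψ a)) + ψ a, by rw [μ.map_add_const]; ring, ?_⟩
      intro i hi z
      rw [Finset.mem_singleton.1 hi]
      simp [sub_eq_neg_add]
    | cons a s ha hs ih =>
      obtain ⟨Ψ, h0, hΨ⟩ := ih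
      refine ⟨(ContinuousMap.const X (-μ.1 (ψ a)) + ψ a) ⊔ Ψ, ?_, ?_⟩
      · rw [μ.2.map_oplus, μ.map_add_const, h0]; simp
      · intro i hi z
        rcases Finset.mem_cons.1 hi with rfl | hi
        · exact le_trans (by simp [sub_eq_neg_add]) (le_max_left _ (Ψ z))
        · exact (hΨ i hi z).trans (le_max_right _ _)
  obtain ⟨Ψ, h0, hΨ⟩ := hsup t htn
  have hlt : ∀ z, φ z - μ.1 φ < Ψ z := fun z => by
    obtain ⟨i, hi, hz⟩ := mem_iUnion₂.1 (ht (mem_univ z))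
    have hz' : μ.1 (ψ i) - ψ i z < μ.1 φ - φ z := hz
    linarith [hΨ i hi z]
  obtain ⟨z, -, hz⟩ := isCompact_univ.exists_isMinOn (univ_nonempty (α := X))
    (f := fun z => Ψ z - φ z) (by fun_prop)
  have hle : μ.1 φ ≤ -(Ψ z - φ z) + μ.1 Ψ := μ.le_add_of_le fun w => by
    have : Ψ z - φ z ≤ Ψ w - φ w := hz (mem_univ w)
    linarith
  linarith [hlt z]

/-- A fibrewise nonpositive weight `g` vanishing somewhere on each fibre of an open surjection
gives a section of the push-forward. -/
theorem exists_continuous_section {f : C(X, Y)} (ho : IsOpenMap f) (hs : Function.Surjective f)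
    (g : C(X, ℝ)) (hg : ∀ x, g x ≤ 0) (hg' : ∀ y, ∃ x, f x = y ∧ g x = 0) :
    ∃ s : IdempotentMeasure Y → IdempotentMeasure X, Continuous s ∧ (∀ ν, map f (s ν) = ν) ∧
      (∀ ν φ (Φ : C(Y, ℝ)), (∀ x, φ x + g x ≤ Φ (f x)) → (s ν).1 φ ≤ ν.1 Φ) ∧
      (∀ ν φ, ∃ Φ : C(Y, ℝ), (∀ x, φ x + g x ≤ Φ (f x)) ∧ (s ν).1 φ = ν.1 Φ) := by
  choose M hle hatt using exists_fiberwise_max f.continuous ho hs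
  have hM : ∀ φ (Φ : C(Y, ℝ)), (∀ x, φ x ≤ Φ (f x)) → M φ ≤ Φ := fun φ Φ h y => by
    obtain ⟨x, rfl, hx⟩ := hatt φ y
    exact hx.symm.le.trans (h x)
  -- Max-plus linearity of `M` over `C(Y)`; with `M g = 0` it gives the section identity.
  have hMadd : ∀ φ (Φ : C(Y, ℝ)), M (Φ.comp f + φ) = Φ + M φ := fun φ Φ => by
    refine le_antisymm (hM _ _ fun x => ?_) fun y => ?_
    · simpa using hle φ x
    · obtain ⟨x, rfl, hx⟩ := hatt φ y
      have := hle (Φ.comp f + φ) x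
      simpa [hx] using this
  have hM0 : M g = 0 := by
    refine le_antisymm (hM _ _ fun x => hg x) fun y => ?_
    obtain ⟨x, rfl, hx⟩ := hg' y
    exact hx.symm.le.trans (hle g x)
  have hMsup : ∀ φ ψ, M (φ ⊔ ψ) = M φ ⊔ M ψ := fun φ ψ => by
    refine le_antisymm (hM _ _ fun x => sup_le_sup (hle φ x) (hle ψ x)) (sup_le ?_ ?_)
    · exact hM _ _ fun x => le_trans (le_max_left _ _) (hle (φ ⊔ ψ) x)
    · exact hM _ _ fun x => le_trans (le_max_right _ _) (hle (φ ⊔ ψ) x)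
  have hodot : ∀ (c : ℝ) (φ : C(X, ℝ)),
      M (ContinuousMap.const X c + φ) = ContinuousMap.const Y c + M φ := fun c φ =>
    hMadd φ (ContinuousMap.const Y c)
  let s : IdempotentMeasure Y → IdempotentMeasure X := fun ν => ⟨fun φ => ν.1 (M (φ + g)), by
    refine ⟨?_, fun c φ => ?_, fun ψ φ => ?_⟩
    · rw [hodot, ν.map_add_const, hM0, ← ContinuousMap.const_zero, ν.map_const, add_zero]
    · rw [add_assoc, hodot, ν.map_add_const]
    · rw [sup_add, hMsup, ν.2.map_oplus]⟩
  refine ⟨s, continuous_induced_rng.2 (continuous_pi fun φ => continuous_eval (M (φ + g))),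
    fun ν => Subtype.ext (funext fun ψ => ?_), fun ν φ Φ h => ν.mono (hM _ _ h),
    fun ν φ => ⟨M (φ + g), hle (φ + g), rfl⟩⟩
  change ν.1 (M (ψ.comp f + g)) = ν.1 ψ
  rw [hMadd, hM0, add_zero]

theorem map_sup'_le {X ι : Type*} [TopologicalSpace X] (μ : IdempotentMeasure X) {T : Finset ι}
    (hT : T.Nonempty) {k : ι → C(X, ℝ)} {c : ℝ} (h : ∀ i ∈ T, μ.1 (k i) ≤ c) :
    μ.1 (T.sup' hT k) ≤ c :=
  Finset.sup'_induction hT k (p := fun φ => μ.1 φ ≤ c)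
    (fun φ hφ ψ hψ => by rw [μ.2.map_oplus]; exact max_le hφ hψ) h

/-- The density of `μ` at `x` is the infimum of `μ ψ - ψ x`; a finite lower bound `b` makes it real,
so one test function attains it up to `ε`. -/
theorem exists_almost_density {X : Type*} [TopologicalSpace X] (μ : IdempotentMeasure X) {x : X} {b : ℝ}
    (hb : ∀ ψ : C(X, ℝ), b ≤ μ.1 ψ - ψ x) {ε : ℝ} (hε : 0 < ε) :
    ∃ ψ₀ : C(X, ℝ), ∀ ψ : C(X, ℝ), μ.1 ψ₀ - ψ₀ x ≤ μ.1 ψ - ψ x + ε := by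
  have hbdd : BddBelow (range fun ψ : C(X, ℝ) => μ.1 ψ - ψ x) := ⟨b, by rintro _ ⟨ψ, rfl⟩; exact hb ψ⟩
  obtain ⟨ψ₀, h⟩ := exists_lt_of_ciInf_lt (lt_add_of_pos_right (⨅ ψ : C(X, ℝ), (μ.1 ψ - ψ x)) hε)
  exact ⟨ψ₀, fun ψ => by linarith [ciInf_le hbdd ψ]⟩

/-- Every idempotent measure `μ` is approximated, on finitely many test functions, by the value
at the push-forward of `μ` of a continuous section of the push-forward. -/
theorem exists_section_approx [CompactSpace Y] {f : C(X, Y)} (ho : IsOpenMap f)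
    (hs : Function.Surjective f) (μ : IdempotentMeasure X) {T : Finset C(X, ℝ)} (hT : T.Nonempty)
    {ε : ℝ} (hε : 0 < ε) :
    ∃ s : IdempotentMeasure Y → IdempotentMeasure X, Continuous s ∧ (∀ ν, map f (s ν) = ν) ∧
      ∀ φ ∈ T, |(s (map f μ)).1 φ - μ.1 φ| ≤ ε := by
  choose x hx using μ.exists_forall_sub_le
  have hψ := fun φ => (map f μ).exists_almost_density (x := f (x φ))
    (fun ψ => hx φ (ψ.comp f)) hε
  choose ψ hψ using hψ
  -- `-K` is a continuous upper bound for the density of `μ`, exact at each `x φ` with `φ ∈ T`.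
  let K : C(X, ℝ) := T.sup' hT fun φ => ContinuousMap.const X (-μ.1 φ) + φ
  have hK : ∀ φ ∈ T, ∀ z, φ z - μ.1 φ ≤ K z := fun φ hφ z => by
    have : (ContinuousMap.const X (-μ.1 φ) + φ) z ≤ K z :=
      Finset.le_sup' (fun φ => ContinuousMap.const X (-μ.1 φ) + φ) hφ z
    simpa [sub_eq_neg_add] using this
  have hK' : ∀ z b, (∀ φ ∈ T, φ z - μ.1 φ ≤ b) → K z ≤ b := fun z b h => by
    rw [ContinuousMap.sup'_apply]
    exact Finset.sup'_le _ _ fun φ hφ => by simpa [sub_eq_neg_add] using h φ hφ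
  have hμK : μ.1 K ≤ 0 := μ.map_sup'_le hT fun φ _ => by rw [μ.map_add_const]; simp
  obtain ⟨M, hM, hMatt⟩ := exists_fiberwise_max f.continuous ho hs (-K)
  let N₀ : C(Y, ℝ) := T.sup' hT fun φ => ContinuousMap.const Y (-(map f μ).1 (ψ φ)) + ψ φ
  have hN₀ : ∀ φ ∈ T, ∀ z, ψ φ z - (map f μ).1 (ψ φ) ≤ N₀ z := fun φ hφ z => by
    have : (ContinuousMap.const Y (-(map f μ).1 (ψ φ)) + ψ φ) z ≤ N₀ z :=
      Finset.le_sup' (fun φ => ContinuousMap.const Y (-(map f μ).1 (ψ φ)) + ψ φ) hφ z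
    simpa [sub_eq_neg_add] using this
  have hN₀' : ∀ z b, (∀ φ ∈ T, ψ φ z - (map f μ).1 (ψ φ) ≤ b) → N₀ z ≤ b := fun z b h => by
    rw [ContinuousMap.sup'_apply]
    exact Finset.sup'_le _ _ fun φ hφ => by simpa [sub_eq_neg_add] using h φ hφ
  -- `-N₀` bounds the density of `map f μ` from above, within `ε` at each `f (x φ)`. Since `-M` is
  -- the fibrewise minimum of `K`, joining it forces `g` below to vanish somewhere on every fibre,
  -- while `map f μ` of `N` stays nonpositive.
  let N : C(Y, ℝ) := N₀ ⊔ -M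
  have hN₀N : ∀ z, N₀ z ≤ N z := fun z => le_max_left _ _
  have hMN : ∀ z, -M z ≤ N z := fun z => le_max_right _ _
  have hμN : (map f μ).1 N ≤ 0 := by
    rw [(map f μ).2.map_oplus]
    refine max_le ((map f μ).map_sup'_le hT fun φ _ => by rw [map_add_const]; simp) ?_
    refine le_trans (μ.mono fun z => ?_) hμK
    have : -K z ≤ M (f z) := hM z
    change -M (f z) ≤ K z
    linarith
  let g : C(X, ℝ) := (-K + N.comp f) ⊓ 0
  have hg : ∀ z, g z = min (-K z + N (f z)) 0 := fun z => rfl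
  obtain ⟨s, hsc, hsec, hle, hatt⟩ := exists_continuous_section ho hs g
    (fun z => (hg z).trans_le (min_le_right _ _)) fun y => by
      obtain ⟨z, rfl, hz⟩ := hMatt y
      refine ⟨z, rfl, (hg z).trans (min_eq_right ?_)⟩
      have : -K z = M (f z) := hz
      linarith [hMN (f z)]
  refine ⟨s, hsc, hsec, fun φ hφ => abs_le.2 ⟨?_, ?_⟩⟩
  · obtain ⟨Φ, hΦ, e⟩ := hatt (map f μ) φ
    rw [e]
    have h1 := hψ φ Φ
    have h2 := hN₀ φ hφ (f (x φ))
    have h3 := hN₀N (f (x φ))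
    have h4 := hΦ (x φ)
    have h5 : K (x φ) ≤ φ (x φ) - μ.1 φ := hK' _ _ fun φ' _ => by linarith [hx φ φ']
    have h6 : N (f (x φ)) ≤ φ (x φ) - μ.1 φ := by
      refine max_le (hN₀' _ _ fun φ' _ => ?_) ?_
      · have : μ.1 φ - φ (x φ) ≤ (map f μ).1 (ψ φ') - ψ φ' (f (x φ)) := hx φ ((ψ φ').comp f)
        linarith
      · have : -K (x φ) ≤ M (f (x φ)) := hM (x φ)
        change -M (f (x φ)) ≤ _
        linarith
    have h7 : N (f (x φ)) - φ (x φ) + μ.1 φ ≤ g (x φ) := by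
      rw [hg]
      exact le_min (by linarith) (by linarith)
    linarith
  -- No `ε` is lost on this side: `φ + g ≤ φ - K + N ∘ f ≤ μ φ + N ∘ f`.
  · have h1 := hle (map f μ) φ (ContinuousMap.const Y (μ.1 φ) + N) fun z => by
      have h2 := (hg z).trans_le (min_le_left _ _)
      have h3 := hK φ hφ z
      change _ ≤ μ.1 φ + N (f z)
      linarith
    rw [map_add_const] at h1
    linarith

theorem exists_finset_of_mem_open {X : Type*} [TopologicalSpace X] {U : Set (IdempotentMeasure X)}
    (hU : IsOpen U) {μ : IdempotentMeasure X} (hμ : μ ∈ U) :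
    ∃ T : Finset C(X, ℝ), T.Nonempty ∧ ∃ ε > 0, ∀ ν : IdempotentMeasure X,
      (∀ φ ∈ T, |ν.1 φ - μ.1 φ| ≤ ε) → ν ∈ U := by
  classical
  obtain ⟨V, hV, rfl⟩ := isOpen_induced_iff.1 hU
  obtain ⟨I, u, hu, hIV⟩ := isOpen_pi_iff.1 hV μ.1 hμ
  have hev : ∀ᶠ ε : ℝ in 𝓝[>] 0, ∀ φ ∈ I, Metric.closedBall (μ.1 φ) ε ⊆ u φ := by
    refine (Filter.eventually_all_finset I).2 fun φ hφ => ?_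
    obtain ⟨δ, hδ, hb⟩ := Metric.isOpen_iff.1 (hu φ hφ).1 _ (hu φ hφ).2
    filter_upwards [Ioo_mem_nhdsGT hδ] with ε hε
    exact (Metric.closedBall_subset_ball hε.2).trans hb
  obtain ⟨ε, hε, hpos⟩ := (hev.and self_mem_nhdsWithin).exists
  refine ⟨insert 0 I, Finset.insert_nonempty _ _, ε, hpos, fun ν hν => hIV fun φ hφ => ?_⟩
  refine hε φ hφ ?_
  rw [Metric.mem_closedBall, Real.dist_eq]
  exact hν φ (Finset.mem_insert_of_mem hφ)

/-- The functor of idempotent measures preserves open surjections. -/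
theorem isOpenMap_map [CompactSpace Y] {f : C(X, Y)} (ho : IsOpenMap f)
    (hs : Function.Surjective f) : IsOpenMap (map f) := by
  intro U hU
  rw [isOpen_iff_mem_nhds]
  rintro _ ⟨μ, hμ, rfl⟩
  obtain ⟨T, hT, ε, hε, h⟩ := exists_finset_of_mem_open hU hμ
  obtain ⟨s, hsc, hsec, happ⟩ := exists_section_approx ho hs μ hT hε
  filter_upwards [hsc.continuousAt.preimage_mem_nhds (hU.mem_nhds (h _ happ))] with ν hν
  exact ⟨s ν, hν, hsec ν⟩

end FiberwiseMaximum

/-! ### Descending openness of saturations from `IX` to `X`. -/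

/-- If saturations of open sets with respect to the push-forward by `f` are open, then so are
saturations of open sets with respect to `f`. -/
theorem isOpen_preimage_image_of_map {X Y : Type*} [TopologicalSpace X] [CompactSpace X]
    [T2Space X] [TopologicalSpace Y] [CompactSpace Y] [T2Space Y] (f : C(X, Y))
    (h : ∀ W : Set (IdempotentMeasure X), IsOpen W → IsOpen (map f ⁻¹' (map f '' W)))
    {U : Set X} (hU : IsOpen U) : IsOpen (f ⁻¹' (f '' U)) := by
  rw [isOpen_iff_mem_nhds]
  rintro x₁ ⟨x₀, hx₀, hx₀₁⟩
  obtain ⟨φ, hφ0, hφ1, -⟩ := exists_continuous_zero_one_of_isClosed hU.isClosed_compl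
    (isClosed_singleton (x := x₀)) (by simpa using hx₀)
  have hW : IsOpen {μ : IdempotentMeasure X | 0 < μ.1 φ} :=
    isOpen_lt continuous_const (continuous_eval φ)
  have hmem : dirac x₁ ∈ map f ⁻¹' (map f '' {μ : IdempotentMeasure X | 0 < μ.1 φ}) := by
    refine ⟨dirac x₀, ?_, by rw [map_dirac, map_dirac, hx₀₁]⟩
    have : φ x₀ = 1 := hφ1 rfl
    simp [dirac_apply, this]
  filter_upwards [continuous_dirac.continuousAt.preimage_mem_nhds ((h _ hW).mem_nhds hmem)]
    with x hx
  obtain ⟨μ, hμ, he⟩ := hx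
  by_contra hxU
  have hμ' : 0 < μ.1 φ := hμ
  -- If the fibre of `x` missed `U`, some `ψ` would vanish at `f x` and equal 1 on this closed
  -- image. Then `φ ≤ μ φ / 2 + |c| ψ ∘ f`, and since `map f μ` is the Dirac measure at `f x`,
  -- applying `μ` gives `μ φ ≤ μ φ / 2`.
  have hclosed : IsClosed (f '' {z | μ.1 φ / 2 ≤ φ z}) :=
    f.continuous.isClosedMap _ (isClosed_le continuous_const φ.continuous)
  obtain ⟨ψ, hψ0, hψ1, hψ⟩ := exists_continuous_zero_one_of_isClosed
    (isClosed_singleton (x := f x)) hclosed (by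
      rw [disjoint_singleton_left]
      rintro ⟨z, hz, hzx⟩
      by_cases hzU : z ∈ U
      · exact hxU ⟨z, hzU, hzx⟩
      · have h0 : φ z = 0 := hφ0 hzU
        have hz' : μ.1 φ / 2 ≤ φ z := hz
        linarith)
  obtain ⟨c, hc⟩ := (isCompact_range φ.continuous).bddAbove
  have hle : ∀ z, φ z ≤ μ.1 φ / 2 + ((|c| • ψ).comp f) z := fun z => by
    change φ z ≤ μ.1 φ / 2 + |c| * ψ (f z)
    by_cases hz : μ.1 φ / 2 ≤ φ z
    · have : ψ (f z) = 1 := hψ1 ⟨z, hz, rfl⟩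
      rw [this]
      have := hc ⟨z, rfl⟩
      linarith [le_abs_self c]
    · have := mul_nonneg (abs_nonneg c) (hψ (f z)).1
      linarith
  have h1 := μ.le_add_of_le hle
  have h2 : (map f μ).1 (|c| • ψ) = (map f (dirac x)).1 (|c| • ψ) := by rw [he]
  have h3 : ψ (f x) = 0 := hψ0 rfl
  rw [map_apply, map_dirac, dirac_apply] at h2
  rw [h2] at h1
  simp only [ContinuousMap.coe_smul, Pi.smul_apply, h3, smul_zero] at h1
  linarith

end IdempotentMeasure

/-! ### Building an ω-system from a family of maps. -/

/-- In a directed preorder, upper bounds of finite sets can be chosen monotonically. -/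
theorem exists_monotone_finset_upperBound (P : Type*) [Preorder P] [Nonempty P]
    [IsDirectedOrder P] :
    ∃ e : Finset P → P, Monotone e ∧ ∀ (s : Finset P), ∀ a ∈ s, a ≤ e s := by
  classical
  have hub := fun s : Finset P => s.exists_le
  choose ub hub using hub
  -- Strong recursion: bound `s` together with the values already chosen on its proper subsets.
  let G : (s : Finset P) → ((t : Finset P) → t ⊂ s → P) → P := fun s r =>
    ub (s ∪ s.ssubsets.attach.image fun t => r t.1 (Finset.mem_ssubsets.1 t.2))
  let e : Finset P → P := fun s => Finset.strongInduction G s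
  have he : ∀ s, e s = ub (s ∪ s.ssubsets.attach.image fun t => e t.1) := fun s =>
    Finset.strongInduction_eq G s
  refine ⟨e, fun s t hst => ?_, fun s a ha => ?_⟩
  · rcases eq_or_ne s t with rfl | hne
    · exact le_rfl
    · rw [he t]
      refine hub _ _ (Finset.mem_union_right _ (Finset.mem_image.2
        ⟨⟨s, Finset.mem_ssubsets.2 (hst.ssubset_of_ne hne)⟩, Finset.mem_attach _ _, rfl⟩))
  · rw [he s]
    exact hub _ _ (Finset.mem_union_left _ ha)

/-- A compact space maps onto the points of a directed inverse limit of its Hausdorff images. -/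
theorem exists_forall_eq_of_directed {X ι : Type*} [TopologicalSpace X] [CompactSpace X]
    [Nonempty ι] {Z : ι → Type*} [∀ i, TopologicalSpace (Z i)] [∀ i, T1Space (Z i)]
    (g : ∀ i, X → Z i) (hg : ∀ i, Continuous (g i)) (hs : ∀ i, Function.Surjective (g i))
    (z : ∀ i, Z i)
    (hdir : ∀ i j, ∃ k, ∀ x, g k x = z k → g i x = z i ∧ g j x = z j) :
    ∃ x, ∀ i, g i x = z i := by
  obtain ⟨x, hx⟩ := IsCompact.nonempty_iInter_of_directed_nonempty_isCompact_isClosed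
    (fun i => g i ⁻¹' {z i})
    (fun i j => by
      obtain ⟨k, hk⟩ := hdir i j
      exact ⟨k, fun x hx => (hk x hx).1, fun x hx => (hk x hx).2⟩)
    (fun i => hs i (z i))
    (fun i => ((isClosed_singleton (x := z i)).preimage (hg i)).isCompact)
    (fun i => (isClosed_singleton (x := z i)).preimage (hg i))
  exact ⟨x, fun i => mem_iInter.1 hx i⟩

/-- A compactum is openly generated as soon as it has a directed, point-separating family of
continuous maps to spaces of countable weight, with saturations of open sets open, which is
continuous along monotone sequences. -/
theorem openlyGenerated_of_family {X : Type u} [TopologicalSpace X] [CompactSpace X]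
    {P : Type u} [Preorder P] [Nonempty P] [IsDirectedOrder P]
    (Y : P → Type u) [∀ a, TopologicalSpace (Y a)] [∀ a, T2Space (Y a)]
    [∀ a, SecondCountableTopology (Y a)] (f : ∀ a, X → Y a) (hf : ∀ a, Continuous (f a))
    (hmono : ∀ a b, a ≤ b → ∀ x y, f b x = f b y → f a x = f a y)
    (hseq : ∀ s : ℕ → P, Monotone s →
      ∃ b, (∀ n, s n ≤ b) ∧ ∀ x y, (∀ n, f (s n) x = f (s n) y) → f b x = f b y)
    (hopen : ∀ a (U : Set X), IsOpen U → IsOpen (f a ⁻¹' (f a '' U)))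
    (hsep : ∀ x y, (∀ a, f a x = f a y) → x = y) : OpenlyGenerated X := by
  classical
  obtain ⟨e, he, hge⟩ := exists_monotone_finset_upperBound P
  -- `P` itself may lack suprema, so the index set becomes its countable subsets, with unions as
  -- suprema. Coordinates are finite subsets: a finite subset of the union of a chain lies in one
  -- member, which gives continuity of the system.
  let A : Type u := {S : Set P // S.Countable}
  let I : A → Type u := fun S => {F : Finset P // (F : Set P) ⊆ S.1}
  let g : ∀ S : A, X → ∀ F : I S, Y (e F.1) := fun S x F => f (e F.1) x
  have hg : ∀ S, Continuous (g S) := fun S => continuous_pi fun F => hf _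
  let Z : A → Type u := fun S => range (g S)
  let π : ∀ S : A, X → Z S := fun S x => ⟨g S x, x, rfl⟩
  have hπ : ∀ S, Continuous (π S) := fun S => (hg S).subtype_mk _
  have hπs : ∀ S, Function.Surjective (π S) := by
    rintro S ⟨_, x, rfl⟩
    exact ⟨x, rfl⟩
  have hπeq : ∀ {S x y}, π S x = π S y ↔ g S x = g S y := fun {S x y} => Subtype.ext_iff
  have hcount : ∀ S : A, Countable (I S) := fun S => by
    have := S.2.to_subtype
    refine Function.Injective.countable
      (f := fun F : I S => F.1.preimage (Subtype.val : S.1 → P) Subtype.val_injective.injOn) ?_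
    rintro ⟨F, hF⟩ ⟨F', hF'⟩ h
    refine Subtype.ext (Finset.ext fun a => ⟨fun ha => ?_, fun ha => ?_⟩)
    · have : (⟨a, hF ha⟩ : S.1) ∈ F.preimage (Subtype.val : S.1 → P) Subtype.val_injective.injOn :=
        Finset.mem_preimage.2 ha
      exact Finset.mem_preimage.1 ((Finset.ext_iff.1 h _).1 this)
    · have : (⟨a, hF' ha⟩ : S.1) ∈ F'.preimage (Subtype.val : S.1 → P) Subtype.val_injective.injOn :=
        Finset.mem_preimage.2 ha
      exact Finset.mem_preimage.1 ((Finset.ext_iff.1 h _).2 this)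
  -- Monotonicity of `e` makes the countable family `e F` directed; a cofinal sequence in it reduces
  -- the fibres of `g S` to those of a single `f b`.
  have hker : ∀ S : A, ∃ b, ∀ x y, g S x = g S y ↔ f b x = f b y := fun S => by
    have := hcount S
    let _ : Encodable (I S) := Encodable.ofCountable _
    let _ : Inhabited (I S) := ⟨⟨∅, by simp⟩⟩
    have hdir : Directed (· ≤ ·) fun F : I S => e F.1 := fun F F' =>
      ⟨⟨F.1 ∪ F'.1, by simpa using ⟨F.2, F'.2⟩⟩, he Finset.subset_union_left,
        he Finset.subset_union_right⟩
    obtain ⟨b, hb, hb'⟩ := hseq _ hdir.sequence_mono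
    refine ⟨b, fun x y => ⟨fun h => hb' _ _ fun n => congrFun h _, fun h => funext fun F => ?_⟩⟩
    exact hmono _ _ ((hdir.le_sequence F).trans (hb _)) _ _ h
  have hπo : ∀ S, IsOpenMap (π S) := fun S U hU => by
    have hq : IsQuotientMap (π S) := ((hπ S).isClosedMap).isQuotientMap (hπ S) (hπs S)
    rw [← hq.isOpen_preimage]
    obtain ⟨b, hb⟩ := hker S
    convert hopen b U hU using 1
    ext x
    exact ⟨fun ⟨y, hy, h⟩ => ⟨y, hy, (hb _ _).1 (hπeq.1 h)⟩,
      fun ⟨y, hy, h⟩ => ⟨y, hy, hπeq.2 ((hb _ _).2 h)⟩⟩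
  let p : ∀ ⦃S T : A⦄, S ≤ T → Z T → Z S := fun S T h z =>
    ⟨fun F => z.1 ⟨F.1, F.2.trans h⟩, by
      obtain ⟨_, x, rfl⟩ := z
      exact ⟨x, rfl⟩⟩
  have hpc : ∀ ⦃S T : A⦄ (h : S ≤ T), Continuous (p h) := fun S T h =>
    Continuous.subtype_mk (continuous_pi fun F =>
      (continuous_apply (⟨F.1, F.2.trans h⟩ : I T)).comp continuous_subtype_val) _
  have hps : ∀ ⦃S T : A⦄ (h : S ≤ T), Function.Surjective (p h) := fun S T h z => by
    obtain ⟨x, rfl⟩ := hπs S z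
    exact ⟨π T x, rfl⟩
  have hpi : InverseSystem p := ⟨fun S z => rfl, fun S T V hST hTV z => rfl⟩
  have hZc : ∀ S, CompactSpace (Z S) := fun S => isCompact_iff_compactSpace.1 (isCompact_range (hg S))
  refine ⟨A, inferInstance, Z, inferInstance, p, ?_, fun S T h U hU => ?_, ?_⟩
  · refine ⟨hpi, hZc, fun S => inferInstance, fun S => ?_, hpc, hps, fun B hB => ?_, ?_⟩
    · have := hcount S
      exact inferInstance
    · refine ⟨⟨⋃ S ∈ B, S.1, hB.biUnion fun S _ => S.2⟩, fun S hS => ?_, fun T hT => ?_⟩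
      · exact subset_biUnion_of_mem (u := fun S : A => S.1) hS
      · exact iUnion₂_subset fun S hS => hT hS
    · intro B β hne hchain hβ
      have hβB : β.1 ⊆ ⋃ S ∈ B, S.1 := by
        have hsub : (⋃ S ∈ B, S.1) ⊆ β.1 := iUnion₂_subset fun S hS => hβ.1 hS
        -- The chain may be uncountable; its union is countable because it lies in `β`.
        let V : A := ⟨⋃ S ∈ B, S.1, β.2.mono hsub⟩
        have hV : V ∈ upperBounds B := fun S hS =>
          subset_biUnion_of_mem (u := fun S : A => S.1) hS
        exact hβ.2 hV
      have hfin : ∀ F : Finset P, (F : Set P) ⊆ β.1 → ∃ S ∈ B, (F : Set P) ⊆ S.1 := fun F hF =>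
        DirectedOn.exists_mem_subset_of_finset_subset_biUnion (f := fun S : A => S.1) hne
          hchain.directedOn (hF.trans hβB)
      have := hZc β
      rw [isHomeomorph_iff_continuous_bijective]
      refine ⟨continuous_induced_rng.2 (continuous_pi fun S => hpc (hβ.1 S.2)), fun z w hzw => ?_, ?_⟩
      · obtain ⟨x, rfl⟩ := hπs β z
        obtain ⟨y, rfl⟩ := hπs β w
        refine hπeq.2 (funext fun F => ?_)
        obtain ⟨S, hS, hFS⟩ := hfin F.1 F.2
        have h1 : π S x = π S y := congrFun (congrArg Subtype.val hzw) ⟨S, hS⟩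
        exact congrFun (hπeq.1 h1) ⟨F.1, hFS⟩
      · rintro ⟨z, hz⟩
        have := hne.to_subtype
        obtain ⟨x, hx⟩ := exists_forall_eq_of_directed (fun S : B => π S.1) (fun S => hπ S.1)
          (fun S => hπs S.1) z fun S T => by
            rcases hchain.total S.2 T.2 with h | h
            · refine ⟨T, fun x hx => ⟨?_, hx⟩⟩
              rw [← hz S T h, ← hx]
            · refine ⟨S, fun x hx => ⟨hx, ?_⟩⟩
              rw [← hz T S h, ← hx]
        exact ⟨π β x, Subtype.ext (funext fun S => hx S)⟩
  · convert hπo S _ (hU.preimage (hπ T)) using 1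
    ext z
    refine ⟨?_, ?_⟩
    · rintro ⟨w, hw, rfl⟩
      obtain ⟨x, rfl⟩ := hπs T w
      exact ⟨x, hw, rfl⟩
    · rintro ⟨x, hx, rfl⟩
      exact ⟨π T x, hx, rfl⟩
  · let Φ : X → inverseLimit p := fun x => ⟨fun S => π S x, fun S T h => rfl⟩
    have hΦ : IsHomeomorph Φ := by
      rw [isHomeomorph_iff_continuous_bijective]
      refine ⟨continuous_induced_rng.2 (continuous_pi fun S => hπ S), fun x y hxy => ?_, ?_⟩
      · refine hsep _ _ fun a => ?_
        have h1 : π ⟨{a}, countable_singleton a⟩ x = π ⟨{a}, countable_singleton a⟩ y :=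
          congrFun (congrArg Subtype.val hxy) _
        exact hmono a (e {a}) (hge _ _ (Finset.mem_singleton_self a)) _ _
          (congrFun (hπeq.1 h1) ⟨{a}, by simp⟩)
      · rintro ⟨z, hz⟩
        have : Nonempty A := ⟨⟨∅, countable_empty⟩⟩
        obtain ⟨x, hx⟩ := exists_forall_eq_of_directed π hπ hπs z fun S T =>
          ⟨⟨S.1 ∪ T.1, S.2.union T.2⟩, fun x hx =>
            ⟨by rw [← hz S ⟨S.1 ∪ T.1, S.2.union T.2⟩ subset_union_left, ← hx],
              by rw [← hz T ⟨S.1 ∪ T.1, S.2.union T.2⟩ subset_union_right, ← hx]⟩⟩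
        exact ⟨x, Subtype.ext (funext fun S => hx S)⟩
    exact ⟨hΦ.homeomorph⟩

/-! ### Factorisation of continuous functions through stages. -/

section Dependence

variable {X : Type*} [TopologicalSpace X] [CompactSpace X]

/-- Functions constant on the classes of some `R i` form a point-separating subalgebra, by
directedness; Stone–Weierstrass applies. -/
theorem exists_approx_of_directed {ι : Type*} [Nonempty ι] (R : ι → X → X → Prop)
    (hdir : ∀ i j, ∃ k, ∀ x y, R k x y → R i x y ∧ R j x y)
    (hsep : ∀ x y, x ≠ y → ∃ i, ∃ φ : C(X, ℝ), (∀ u v, R i u v → φ u = φ v) ∧ φ x ≠ φ y)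
    (h : C(X, ℝ)) {ε : ℝ} (hε : 0 < ε) :
    ∃ i, ∃ φ : C(X, ℝ), (∀ u v, R i u v → φ u = φ v) ∧ ∀ x, |h x - φ x| ≤ ε := by
  let S : Subalgebra ℝ C(X, ℝ) :=
    { carrier := {φ | ∃ i, ∀ u v, R i u v → φ u = φ v}
      mul_mem' := by
        rintro φ ψ ⟨i, hi⟩ ⟨j, hj⟩
        obtain ⟨k, hk⟩ := hdir i j
        exact ⟨k, fun u v h => congrArg₂ (· * ·) (hi u v (hk u v h).1) (hj u v (hk u v h).2)⟩
      add_mem' := by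
        rintro φ ψ ⟨i, hi⟩ ⟨j, hj⟩
        obtain ⟨k, hk⟩ := hdir i j
        exact ⟨k, fun u v h => congrArg₂ (· + ·) (hi u v (hk u v h).1) (hj u v (hk u v h).2)⟩
      algebraMap_mem' := fun r => ⟨Classical.arbitrary ι, fun _ _ _ => rfl⟩ }
  have hS : S.SeparatesPoints := fun x y hxy => by
    obtain ⟨i, φ, hφ, hne⟩ := hsep x y hxy
    exact ⟨φ, ⟨φ, ⟨i, hφ⟩, rfl⟩, hne⟩
  have htop := ContinuousMap.subalgebra_topologicalClosure_eq_top_of_separatesPoints S hS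
  have hmem : h ∈ closure (S : Set C(X, ℝ)) := by
    rw [← Subalgebra.topologicalClosure_coe, htop]
    trivial
  obtain ⟨φ, ⟨i, hi⟩, hd⟩ := Metric.mem_closure_iff.1 hmem ε hε
  exact ⟨i, φ, hi, fun x => (ContinuousMap.dist_apply_le_dist x).trans hd.le⟩

/-- A single stage dominates those of a sequence of approximants with error `1 / (n + 1)`, so the
uniform limit is constant there too. -/
theorem exists_dependent_of_countably_directed {ι : Type*} [Nonempty ι] (R : ι → X → X → Prop)
    (hdir : ∀ s : ℕ → ι, ∃ k, ∀ n x y, R k x y → R (s n) x y)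
    (hsep : ∀ x y, x ≠ y → ∃ i, ∃ φ : C(X, ℝ), (∀ u v, R i u v → φ u = φ v) ∧ φ x ≠ φ y)
    (h : C(X, ℝ)) : ∃ i, ∀ x y, R i x y → h x = h y := by
  have happ := fun n : ℕ => exists_approx_of_directed R (fun i j => by
      obtain ⟨k, hk⟩ := hdir fun n => if n = 0 then i else j
      exact ⟨k, fun x y hxy => ⟨hk 0 x y hxy, hk 1 x y hxy⟩⟩)
    hsep h (ε := 1 / (n + 1 : ℝ)) (by positivity)
  choose i φ hφ hd using happ
  obtain ⟨k, hk⟩ := hdir i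
  refine ⟨k, fun x y hxy => eq_of_forall_dist_le fun ε hε => ?_⟩
  obtain ⟨n, hn⟩ := exists_nat_one_div_lt (half_pos hε)
  have h1 := abs_le.1 (hd n x)
  have h2 := abs_le.1 (hd n y)
  have h3 := hφ n x y (hk n x y hxy)
  rw [Real.dist_eq]
  exact abs_le.2 ⟨by linarith, by linarith⟩

/-- The factor exists on the closed range, a quotient of `X`; Tietze extends it to `W`. -/
theorem ContinuousMap.exists_comp_eq_of_factorsThrough {W : Type*} [TopologicalSpace W]
    [CompactSpace W] [T2Space W] (f : C(X, W)) (φ : C(X, ℝ))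
    (h : ∀ x y, f x = f y → φ x = φ y) : ∃ ψ : C(W, ℝ), ψ.comp f = φ := by
  let r : C(X, range f) := ⟨rangeFactorization f, f.continuous.subtype_mk _⟩
  have hr : IsQuotientMap r :=
    r.continuous.isClosedMap.isQuotientMap r.continuous rangeFactorization_surjective
  obtain ⟨ψ, hψ⟩ := ContinuousMap.exists_extension
    ((isCompact_range f.continuous).isClosed.isClosedEmbedding_subtypeVal)
    (hr.lift φ fun x y hxy => h x y (congrArg Subtype.val hxy))
  refine ⟨ψ, ContinuousMap.ext fun x => ?_⟩
  have h1 := DFunLike.congr_fun hψ (r x)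
  have h2 := DFunLike.congr_fun (hr.lift_comp φ fun x y hxy => h x y (congrArg Subtype.val hxy)) x
  exact h1.trans h2

end Dependence

theorem exists_continuous_ne {W : Type*} [TopologicalSpace W] [CompactSpace W] [T2Space W]
    {x y : W} (h : x ≠ y) : ∃ φ : C(W, ℝ), φ x ≠ φ y := by
  by_contra! hc
  exact h (IdempotentMeasure.dirac_injective (Subtype.ext (funext hc)))

namespace IdempotentMeasure

/-- A directed family of maps separating the points of `Z` separates idempotent measures. -/
theorem eq_of_forall_map_eq {Z : Type*} [TopologicalSpace Z] [CompactSpace Z] {ι : Type*}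
    [Nonempty ι] {W : ι → Type*} [∀ i, TopologicalSpace (W i)] [∀ i, CompactSpace (W i)]
    [∀ i, T2Space (W i)] (g : ∀ i, C(Z, W i))
    (hdir : ∀ i j, ∃ k, ∀ x y, g k x = g k y → g i x = g i y ∧ g j x = g j y)
    (hinj : ∀ x y, (∀ i, g i x = g i y) → x = y) {μ ν : IdempotentMeasure Z}
    (h : ∀ i, map (g i) μ = map (g i) ν) : μ = ν := by
  refine Subtype.ext (funext fun φ => eq_of_forall_approx φ fun ε hε => ?_)
  obtain ⟨i, φ', hφ', hd⟩ := exists_approx_of_directed (fun i x y => g i x = g i y) hdir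
    (fun x y hxy => by
      by_contra! hc
      refine hxy (hinj x y fun i => ?_)
      by_contra hne
      obtain ⟨ψ, hψ⟩ := exists_continuous_ne hne
      exact hψ (hc i (ψ.comp (g i)) fun u v huv => congrArg ψ huv)) φ hε
  obtain ⟨ψ, rfl⟩ := (g i).exists_comp_eq_of_factorsThrough φ' hφ'
  exact ⟨_, hd, congrFun (congrArg Subtype.val (h i)) ψ⟩

/-- A continuous map from a space of idempotent measures to a space of countable weight depends
only on countably many test functions. -/
theorem exists_countable_dependence {X W : Type*} [TopologicalSpace X] [CompactSpace X]
    [TopologicalSpace W] [CompactSpace W] [T2Space W] [SecondCountableTopology W]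
    (g : C(IdempotentMeasure X, W)) :
    ∃ D : Set C(X, ℝ), D.Countable ∧
      ∀ μ ν : IdempotentMeasure X, (∀ φ ∈ D, μ.1 φ = ν.1 φ) → g μ = g ν := by
  obtain ⟨E, hE, hEd⟩ := TopologicalSpace.exists_countable_dense C(W, ℝ)
  have : Nonempty {D : Set C(X, ℝ) // D.Countable} := ⟨⟨∅, countable_empty⟩⟩
  have hdep := exists_dependent_of_countably_directed
    (fun (D : {D : Set C(X, ℝ) // D.Countable}) (μ ν : IdempotentMeasure X) =>
      ∀ φ ∈ D.1, μ.1 φ = ν.1 φ)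
    (fun s => ⟨⟨⋃ n, (s n).1, countable_iUnion fun n => (s n).2⟩, fun n μ ν h φ hφ =>
      h φ (mem_iUnion.2 ⟨n, hφ⟩)⟩)
    (fun μ ν hne => by
      by_contra! hc
      refine hne (Subtype.ext (funext fun φ => ?_))
      exact hc ⟨{φ}, countable_singleton φ⟩ ⟨fun μ => μ.1 φ, continuous_eval φ⟩
        fun μ ν h => h φ rfl)
  choose D hD using fun ψ : C(W, ℝ) => hdep (ψ.comp g)
  refine ⟨⋃ ψ ∈ E, (D ψ).1, hE.biUnion fun ψ _ => (D ψ).2, fun μ ν h => ?_⟩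
  refine dirac_injective (eq_of_eqOn_dense hEd fun ψ hψ => ?_)
  exact hD ψ μ ν fun φ hφ => h φ (mem_biUnion hψ hφ)

end IdempotentMeasure

/-! ### Limit projections of an ω-system. -/

section OmegaSystem

variable {A : Type u} [PartialOrder A] {F : A → Type v} [∀ a, TopologicalSpace (F a)]
  {p : ∀ ⦃a b : A⦄, a ≤ b → F b → F a}

namespace IsOmegaSystem

theorem nonempty (hs : IsOmegaSystem F p) : Nonempty A :=
  let ⟨b, _⟩ := hs.complete ∅ countable_empty
  ⟨b⟩

theorem isDirectedOrder (hs : IsOmegaSystem F p) : IsDirectedOrder A :=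
  ⟨fun a b => by
    obtain ⟨c, hc⟩ := hs.complete {a, b} ((countable_singleton b).insert a)
    exact ⟨c, hc.1 (by simp), hc.1 (by simp)⟩⟩

theorem bonding_comp (hs : IsOmegaSystem F p) {a b c : A} (hab : a ≤ b) (hbc : b ≤ c) (x : F c) :
    p hab (p hbc x) = p (hab.trans hbc) x :=
  hs.inverseSystem.map_map hab hbc x

/-- At the least upper bound, continuity of the system makes the earlier coordinates jointly
injective. -/
theorem exists_seq_bound (hs : IsOmegaSystem F p) {s : ℕ → A} (hm : Monotone s) :
    ∃ (b : A) (h : ∀ n, s n ≤ b), ∀ x y : F b, (∀ n, p (h n) x = p (h n) y) → x = y := by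
  obtain ⟨b, hb⟩ := hs.complete (range s) (countable_range s)
  have := hs.inverseSystem
  refine ⟨b, fun n => hb.1 ⟨n, rfl⟩, fun x y hxy => ?_⟩
  refine (hs.continuous_system (range s) b (range_nonempty s) hm.isChain_range hb).injective ?_
  refine Subtype.ext (funext ?_)
  rintro ⟨_, n, rfl⟩
  exact hxy n

/-- Families over `y` that are coherent below a stage form closed nonempty sets, decreasing in the
stage; a common point is a thread. -/
theorem surjective_proj (hs : IsOmegaSystem F p) (c : A) :
    Function.Surjective fun x : inverseLimit p => x.1 c := by
  classical
  intro y
  have := hs.isDirectedOrder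
  have := hs.compact
  have := hs.hausdorff
  let K : {b : A // c ≤ b} → Set (∀ a, F a) := fun b =>
    {x | x c = y ∧ ∀ a (h : a ≤ b.1), p h (x b.1) = x a}
  have hK : ∀ b, IsClosed (K b) := fun b => by
    have e : K b = {x | x c = y} ∩ ⋂ (a : A) (h : a ≤ b.1), {x | p h (x b.1) = x a} := by
      ext x; simp [K]
    rw [e]
    refine (isClosed_eq (continuous_apply c) continuous_const).inter (isClosed_iInter fun a =>
      isClosed_iInter fun h => isClosed_eq ?_ (continuous_apply a))
    exact (hs.continuous_bonding h).comp (continuous_apply b.1)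
  have hne : ∀ a, Nonempty (F a) := fun a => by
    obtain ⟨k, hak, hck⟩ := exists_ge_ge a c
    obtain ⟨z, -⟩ := hs.surjective_bonding hck y
    exact ⟨p hak z⟩
  have : Nonempty {b : A // c ≤ b} := ⟨⟨c, le_rfl⟩⟩
  obtain ⟨x, hx⟩ := IsCompact.nonempty_iInter_of_directed_nonempty_isCompact_isClosed K
    (fun b b' => by
      obtain ⟨k, hbk, hbk'⟩ := exists_ge_ge b.1 b'.1
      have key : ∀ d : {b : A // c ≤ b}, d.1 ≤ k → K ⟨k, b.2.trans hbk⟩ ⊆ K d :=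
        fun d hd x hx => ⟨hx.1, fun a h => by
          rw [← hx.2 a (h.trans hd), ← hx.2 d.1 hd, hs.bonding_comp]⟩
      exact ⟨⟨k, b.2.trans hbk⟩, key b hbk, key b' hbk'⟩)
    (fun b => by
      obtain ⟨z, hz⟩ := hs.surjective_bonding b.2 y
      refine ⟨fun a => if h : a ≤ b.1 then p h z else (hne a).some, ?_, fun a h => ?_⟩
      · simp only [b.2, dif_pos, hz]
      · simp only [h, le_refl, dif_pos, hs.bonding_comp])
    (fun b => (hK b).isCompact) hK
  have hx' := mem_iInter.1 hx
  refine ⟨⟨x, fun a b hab => ?_⟩, (hx' ⟨c, le_rfl⟩).1⟩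
  obtain ⟨k, hbk, hck⟩ := exists_ge_ge b c
  rw [← (hx' ⟨k, hck⟩).2 a (hab.trans hbk), ← (hx' ⟨k, hck⟩).2 b hbk, hs.bonding_comp]

/-- A basic neighbourhood involves finitely many coordinates, so it can be read at one stage `b ≥
a`, where the bonding map is open. -/
theorem isOpenMap_proj (hs : IsOmegaSystem F p) (ho : ∀ ⦃a b : A⦄ (h : a ≤ b), IsOpenMap (p h))
    (a : A) : IsOpenMap fun x : inverseLimit p => x.1 a := by
  classical
  intro U hU
  have := hs.isDirectedOrder
  have := hs.nonempty
  rw [isOpen_iff_mem_nhds]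
  rintro _ ⟨x, hx, rfl⟩
  obtain ⟨V, hV, rfl⟩ := isOpen_induced_iff.1 hU
  obtain ⟨I, u, hu, hIV⟩ := isOpen_pi_iff.1 hV x.1 hx
  obtain ⟨b, hb⟩ := (insert a I).exists_le
  have hab : a ≤ b := hb a (Finset.mem_insert_self a I)
  have hIb : ∀ i ∈ I, i ≤ b := fun i hi => hb i (Finset.mem_insert_of_mem hi)
  let W : Set (F b) := ⋂ i : I, p (hIb i.1 i.2) ⁻¹' u i.1
  have hW : IsOpen W := isOpen_iInter_of_finite fun i =>
    (hu i.1 i.2).1.preimage (hs.continuous_bonding _)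
  have hxW : x.1 b ∈ W := mem_iInter.2 fun i => by
    rw [mem_preimage, x.2]
    exact (hu i.1 i.2).2
  refine Filter.mem_of_superset ((ho hab W hW).mem_nhds ⟨x.1 b, hxW, x.2 a b hab⟩) ?_
  rintro _ ⟨w, hw, rfl⟩
  obtain ⟨z, rfl⟩ := hs.surjective_proj b w
  refine ⟨z, hIV fun i hi => ?_, (z.2 a b hab).symm⟩
  have := mem_iInter.1 hw ⟨i, hi⟩
  rwa [mem_preimage, z.2] at this

end IsOmegaSystem

theorem OpenlyGenerated.exists_projections {X : Type u} [TopologicalSpace X]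
    (hX : OpenlyGenerated X) :
    ∃ (A : Type u) (_ : PartialOrder A) (F : A → Type u) (_ : ∀ a, TopologicalSpace (F a))
      (p : ∀ ⦃a b : A⦄, a ≤ b → F b → F a) (q : ∀ a, C(X, F a)),
      IsOmegaSystem F p ∧ (∀ a, IsOpenMap (q a)) ∧ (∀ a, Function.Surjective (q a)) ∧
        (∀ a b (h : a ≤ b) x, p h (q b x) = q a x) ∧ ∀ x y, (∀ a, q a x = q a y) → x = y := by
  obtain ⟨A, _, F, _, p, hs, ho, ⟨e⟩⟩ := hX
  refine ⟨A, inferInstance, F, inferInstance, p,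
    fun a => ⟨fun x => (e x).1 a, (continuous_apply a).comp
      (continuous_subtype_val.comp e.continuous)⟩, hs, fun a => ?_, fun a => ?_, fun a b h x => ?_,
    fun x y h => ?_⟩
  · exact (hs.isOpenMap_proj ho a).comp e.isOpenMap
  · exact (hs.surjective_proj a).comp e.surjective
  · exact (e x).2 a b h
  · exact e.injective (Subtype.ext (funext h))

end OmegaSystem

/-! ### The two implications. -/

theorem openlyGenerated_idempotentMeasure {X : Type u} [TopologicalSpace X] [CompactSpace X]
    (hX : OpenlyGenerated X) : OpenlyGenerated (IdempotentMeasure X) := by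
  obtain ⟨A, _, F, _, p, q, hs, hqo, hqs, hpq, hsep⟩ := hX.exists_projections
  have := hs.nonempty
  have := hs.isDirectedOrder
  have := hs.compact
  have := hs.hausdorff
  have := hs.weight_le
  have hmono : ∀ a b, a ≤ b → ∀ x y, q b x = q b y → q a x = q a y := fun a b h x y hxy => by
    rw [← hpq a b h, ← hpq a b h, hxy]
  let P : ∀ {a b : A}, a ≤ b → C(F b, F a) := fun h => ⟨p h, hs.continuous_bonding h⟩
  have hP : ∀ {a b : A} (h : a ≤ b) (μ : IdempotentMeasure X),
      (μ.map (q b)).map (P h) = μ.map (q a) := fun {a b} h μ => by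
    rw [← IdempotentMeasure.map_comp]
    exact congrArg (fun g => IdempotentMeasure.map g μ) (ContinuousMap.ext (hpq a b h))
  refine openlyGenerated_of_family (fun a => IdempotentMeasure (F a))
    (fun a => IdempotentMeasure.map (q a)) (fun a => IdempotentMeasure.continuous_map (q a))
    (fun a b h μ ν e => ?_) (fun s hm => ?_) (fun a U hU => ?_) (fun μ ν h => ?_)
  · rw [← hP h, ← hP h, e]
  · obtain ⟨b, hb, hinj⟩ := hs.exists_seq_bound hm
    refine ⟨b, hb, fun μ ν h => ?_⟩
    refine IdempotentMeasure.eq_of_forall_map_eq (fun n => P (hb n)) (fun i j => ?_)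
      (fun x y hxy => hinj x y hxy) fun n => by rw [hP, hP, h n]
    refine ⟨max i j, fun x y hxy => ?_⟩
    have hxy' : p (hb (max i j)) x = p (hb (max i j)) y := hxy
    constructor
    · change p _ x = p _ y
      rw [← hs.bonding_comp (hm (le_max_left i j)) (hb (max i j)), hxy', hs.bonding_comp]
    · change p _ x = p _ y
      rw [← hs.bonding_comp (hm (le_max_right i j)) (hb (max i j)), hxy', hs.bonding_comp]
  · exact (IdempotentMeasure.isOpenMap_map (hqo a) (hqs a) U hU).preimage
      (IdempotentMeasure.continuous_map (q a))
  · refine IdempotentMeasure.eq_of_forall_map_eq q (fun a b => ?_) hsep h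
    obtain ⟨c, hac, hbc⟩ := exists_ge_ge a b
    exact ⟨c, fun x y h => ⟨hmono a c hac x y h, hmono b c hbc x y h⟩⟩

theorem openlyGenerated_of_idempotentMeasure {X : Type u} [TopologicalSpace X] [CompactSpace X]
    [T2Space X] (hX : OpenlyGenerated (IdempotentMeasure X)) : OpenlyGenerated X := by
  obtain ⟨A, _, F, _, p, q, hs, hqo, hqs, hpq, hsep⟩ := hX.exists_projections
  have := hs.nonempty
  have := hs.isDirectedOrder
  have := hs.compact
  have := hs.hausdorff
  have := hs.weight_le
  have hmono : ∀ {a b}, a ≤ b → ∀ {x y}, q b x = q b y → q a x = q a y := fun {a b} h {x y} hxy => by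
    rw [← hpq a b h, ← hpq a b h, hxy]
  let f : ∀ a, C(X, F a) := fun a => (q a).comp ⟨_, IdempotentMeasure.continuous_dirac⟩
  let P : ∀ {a b : A}, a ≤ b → C(F b, F a) := fun h => ⟨p h, hs.continuous_bonding h⟩
  have hP : ∀ {a b : A} (h : a ≤ b) (μ : IdempotentMeasure X),
      (μ.map (f b)).map (P h) = μ.map (f a) := fun {a b} h μ => by
    rw [← IdempotentMeasure.map_comp]
    exact congrArg (fun g => IdempotentMeasure.map g μ) (ContinuousMap.ext fun x => hpq a b h _)
  have hdep : ∀ φ : C(X, ℝ), ∃ a, ∀ μ ν, q a μ = q a ν → μ.1 φ = ν.1 φ := fun φ =>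
    exists_dependent_of_countably_directed (fun a μ ν => q a μ = q a ν)
      (fun s => by
        obtain ⟨b, hb⟩ := hs.complete (range s) (countable_range s)
        exact ⟨b, fun n μ ν h => hmono (hb.1 ⟨n, rfl⟩) h⟩)
      (fun μ ν hne => by
        by_contra! hc
        refine hne (hsep μ ν fun a => ?_)
        by_contra hne'
        obtain ⟨ψ, hψ⟩ := exists_continuous_ne hne'
        exact hψ (hc a (ψ.comp (q a)) fun u v huv => congrArg ψ huv))
      ⟨fun μ => μ.1 φ, IdempotentMeasure.continuous_eval φ⟩
  choose d hd using hdep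
  -- One back-and-forth step. The stage `b` dominates those determining the countably many test
  -- functions behind `q a`, and those for a dense set of functions pulled back along `f a`. On
  -- Dirac measures the former shows that these test functions factor through `f b`.
  have hstep : ∀ a, ∃ b, a ≤ b ∧ ∀ μ ν : IdempotentMeasure X,
      (q b μ = q b ν → μ.map (f a) = ν.map (f a)) ∧ (μ.map (f b) = ν.map (f b) → q a μ = q a ν) := by
    intro a
    obtain ⟨D, hD, hDq⟩ := IdempotentMeasure.exists_countable_dependence (q a)
    obtain ⟨E, hE, hEd⟩ := TopologicalSpace.exists_countable_dense C(F a, ℝ)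
    obtain ⟨b, hb⟩ := hs.complete
      (insert a (d '' D ∪ (fun ψ : C(F a, ℝ) => d (ψ.comp (f a))) '' E))
      (((hD.image _).union (hE.image _)).insert a)
    refine ⟨b, hb.1 (mem_insert _ _), fun μ ν => ⟨fun h => ?_, fun h => hDq μ ν fun φ hφ => ?_⟩⟩
    · refine IdempotentMeasure.eq_of_eqOn_dense hEd fun ψ hψ => hd (ψ.comp (f a)) μ ν ?_
      exact hmono (hb.1 (mem_insert_of_mem _ (Or.inr ⟨ψ, hψ, rfl⟩))) h
    · obtain ⟨ψ, rfl⟩ := (f b).exists_comp_eq_of_factorsThrough φ fun x y hxy =>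
        hd φ (.dirac x) (.dirac y) (hmono (hb.1 (mem_insert_of_mem _ (Or.inl ⟨φ, hφ, rfl⟩))) hxy)
      exact congrFun (congrArg Subtype.val h) ψ
  choose t hat ht using hstep
  let Good : A → Prop := fun a => ∀ μ ν : IdempotentMeasure X,
    q a μ = q a ν ↔ μ.map (f a) = ν.map (f a)
  have hinj : ∀ {s : ℕ → A}, Monotone s → ∃ (b : A) (_ : ∀ n, s n ≤ b),
      (∀ x y, (∀ n, q (s n) x = q (s n) y) → q b x = q b y) ∧
      ∀ μ ν : IdempotentMeasure X, (∀ n, μ.map (f (s n)) = ν.map (f (s n))) →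
        μ.map (f b) = ν.map (f b) := by
    intro s hm
    obtain ⟨b, hb, hbi⟩ := hs.exists_seq_bound hm
    refine ⟨b, hb, fun x y h => hbi _ _ fun n => by rw [hpq, hpq, h n], fun μ ν h => ?_⟩
    refine IdempotentMeasure.eq_of_forall_map_eq (fun n => P (hb n)) (fun i j => ?_)
      (fun x y hxy => hbi x y hxy) fun n => by rw [hP, hP, h n]
    refine ⟨max i j, fun x y hxy => ?_⟩
    have hxy' : p (hb (max i j)) x = p (hb (max i j)) y := hxy
    constructor
    · change p _ x = p _ y
      rw [← hs.bonding_comp (hm (le_max_left i j)) (hb (max i j)), hxy', hs.bonding_comp]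
    · change p _ x = p _ y
      rw [← hs.bonding_comp (hm (le_max_right i j)) (hb (max i j)), hxy', hs.bonding_comp]
  -- Iterating the step interleaves the two fibre relations; at the supremum each is the
  -- intersection of the earlier ones, so they agree.
  have hcof : ∀ a, ∃ b, a ≤ b ∧ Good b := fun a => by
    let s : ℕ → A := fun n => t^[n] a
    have hsucc : ∀ n, s (n + 1) = t (s n) := fun n => Function.iterate_succ_apply' t n a
    have hm : Monotone s := monotone_nat_of_le_succ fun n => by rw [hsucc]; exact hat _
    obtain ⟨b, hb, hbq, hbf⟩ := hinj hm
    refine ⟨b, hb 0, fun μ ν => ⟨fun h => hbf μ ν fun n => ?_, fun h => hbq μ ν fun n => ?_⟩⟩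
    · refine (ht (s n) μ ν).1 ?_
      rw [← hsucc]
      exact hmono (hb _) h
    · refine (ht (s n) μ ν).2 ?_
      rw [← hsucc, ← hP (hb _), ← hP (hb _), h]
  have : Nonempty {a // Good a} := by
    obtain ⟨b, -, hb⟩ := hcof (Classical.arbitrary A)
    exact ⟨⟨b, hb⟩⟩
  have : IsDirectedOrder {a // Good a} := ⟨fun a b => by
    obtain ⟨c, hac, hbc⟩ := exists_ge_ge a.1 b.1
    obtain ⟨e, hce, he⟩ := hcof c
    exact ⟨⟨e, he⟩, hac.trans hce, hbc.trans hce⟩⟩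
  refine openlyGenerated_of_family (P := {a // Good a}) (fun a => F a.1) (fun a => f a.1)
    (fun a => (f a.1).continuous) (fun a b h x y hxy => hmono h hxy) (fun s hm => ?_)
    (fun a U hU => ?_) (fun x y h => ?_)
  · obtain ⟨b, hb, hbq, hbf⟩ := hinj (s := fun n => (s n).1) fun i j h => hm h
    refine ⟨⟨b, fun μ ν => ⟨fun h => hbf μ ν fun n => ?_, fun h => hbq μ ν fun n => ?_⟩⟩,
      hb, fun x y h => hbq _ _ h⟩
    · exact ((s n).2 μ ν).1 (hmono (hb n) h)
    · refine ((s n).2 μ ν).2 ?_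
      rw [← hP (hb n), ← hP (hb n), h]
  · refine IdempotentMeasure.isOpen_preimage_image_of_map (f a.1) (fun W hW => ?_) hU
    -- At a good stage the saturations under `q a` and under `map (f a)` coincide.
    convert (hqo a.1 W hW).preimage (q a.1).continuous using 1
    ext μ
    exact ⟨fun ⟨ν, hν, h⟩ => ⟨ν, hν, (a.2 ν μ).2 h⟩, fun ⟨ν, hν, h⟩ => ⟨ν, hν, (a.2 ν μ).1 h⟩⟩
  · refine IdempotentMeasure.dirac_injective (hsep _ _ fun a => ?_)
    obtain ⟨b, hab, hb⟩ := hcof a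
    exact hmono hab (h ⟨b, hb⟩)

theorem mainTheorem7 (X : Type u) [TopologicalSpace X] [CompactSpace X] [T2Space X] :
    OpenlyGenerated (IdempotentMeasure X) ↔ OpenlyGenerated X :=
  ⟨openlyGenerated_of_idempotentMeasure, openlyGenerated_idempotentMeasure⟩
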